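/- Let $X$ be a complete metric space and let $S(t)$, $t\ge 0$, be a semiflow on $X$ (that is, $(t,x)\mapsto S(t)x$ is continuous on $[0,\infty)\times X$, $S(0)=\mathrm{id}$ and $S(t+s)=S(t)S(s)$) which is asymptotically compact: if $(x_n)$ is bounded, $t_n\to+\infty$ and $(S(t_n)x_n)$ is bounded, then $(S(t_n)x_n)$ has a convergent subsequence. Let $\mathscr A\subset X$ be an attractor of $S(t)$, i.e. a compact set with $S(t)\mathscr A=\mathscr A$ for all $t\ge0$ that attracts a neighborhood of itself, and let $\Omega=\{x\in X: \lim_{t\to\infty}d(S(t)x,\mathscr A)=0\}$ be its attraction basin. Let $\{M_1,\dots,M_l\}$ be a Morse decomposition of $\mathscr A$: there are attractors $\emptyset=A_0\subsetneq A_1\subsetneq\dots\subsetneq A_l=\mathscr A$ of the restriction of $S(t)$ to $\mathscr A$ such that $M_j=A_j\cap A_{j-1}^*$ for $1\le j\le l$, where $A_{j}^*=\{x\in\mathscr A:\omega(x)\cap A_{j}=\emptyset\}$. Let $V:\Omega\to\mathbb R$ be a strict Morse-Lyapunov function: $V$ is continuous, $V$ is constant on each $M_j$, $V(S(t)x)<V(x)$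 for all $x\in\Omega\setminus\bigcup_j M_j$ and $t>0$ (so $V$ decreases strictly along each trajectory as long as it is outside the Morse sets), and $V(M_1)<V(M_2)<\dots<V(M_l)$. The numbers $V(M_j)$ are called the generalized critical values of $V$, and $V_r=\{x\in\Omega: V(x)\le r\}$ for $r\in\mathbb R$. Suppose that for some $k$ the Morse set $M_k$ consists of exactly one point, an equilibrium $E$ of the semiflow, let $c=V(M_k)$, and let $a<c\le b$ be such that $c$ is the only generalized critical value of $V$ in $[a,b]$. Then for singular homology with coefficients in an arbitrary abelian group, $$H_q(V_b,V_a)\cong H_q(V_c,\,V_c\setminus M_k),\qquad q=0,1,2,\dots$$ -/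

import Mathlib

open Set Filter Topology
open scoped NNReal

namespace MorseAttractor

universe u v

section Dynamics

variable {X : Type u} [MetricSpace X]

/-- Asymptotic compactness of a semiflow: if `x n` is bounded, `t n → ∞` and `S (t n) (x n)` is
bounded, then `S (t n) (x n)` has a convergent subsequence. -/
def IsAsymptoticallyCompact (S : Flow ℝ≥0 X) : Prop :=
  ∀ (x : ℕ → X) (t : ℕ → ℝ≥0), Bornology.IsBounded (range x) → Tendsto t atTop atTop →
    Bornology.IsBounded (range fun n => S (t n) (x n)) →
    ∃ (y : X) (φ : ℕ → ℕ), StrictMono φ ∧ Tendsto (fun n => S (t (φ n)) (x (φ n))) atTop (𝓝 y)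

/-- `A` attracts `B`: for every `ε > 0` there is a `T > 0` with `S(t) B ⊆ B(A, ε)` for `t > T`. -/
def Attracts (S : Flow ℝ≥0 X) (A B : Set X) : Prop :=
  ∀ ε : ℝ, 0 < ε → ∃ T : ℝ≥0, 0 < T ∧ ∀ t : ℝ≥0, T < t → S t '' B ⊆ Metric.thickening ε A

/-- The attraction basin of `A`: the points `x` with `d(S(t) x, A) → 0` as `t → ∞`.
(The extended distance is used, so that no point is attracted by the empty set.) -/
def basin (S : Flow ℝ≥0 X) (A : Set X) : Set X :=
  {x | Tendsto (fun t : ℝ≥0 => Metric.infEDist (S t x) A) atTop (𝓝 0)}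

/-- `A` is an attractor of `S`: a compact invariant set (`S(t) A = A` for all `t ≥ 0`)
which attracts a neighborhood of itself. -/
def IsAttractor (S : Flow ℝ≥0 X) (A : Set X) : Prop :=
  IsCompact A ∧ (∀ t : ℝ≥0, S t '' A = A) ∧ ∃ U ∈ 𝓝ˢ A, Attracts S A U

/-- `A` is an attractor of `S` in the invariant set `K`, that is, an attractor of the restriction
of `S` to `K`; the neighborhoods of `A` in the space `K` are the sets `U ∩ K` with `U` a
neighborhood of `A` in `X`. -/
def IsAttractorIn (S : Flow ℝ≥0 X) (K A : Set X) : Prop :=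
  A ⊆ K ∧ IsCompact A ∧ (∀ t : ℝ≥0, S t '' A = A) ∧ ∃ U ∈ 𝓝ˢ A, Attracts S A (U ∩ K)

/-- The repeller of `S` in `K` dual to `A`: the points of `K` whose `ω`-limit set
does not meet `A`. -/
def dualRepeller (S : Flow ℝ≥0 X) (K A : Set X) : Set X :=
  {x | x ∈ K ∧ omegaLimit atTop S {x} ∩ A = ∅}

/-- `M 0, …, M (l - 1)` is a Morse decomposition of the attractor `K`: there are attractors
`∅ = A 0 ⊂ A 1 ⊂ ⋯ ⊂ A l = K` of `S` in `K`, with strict inclusions, such that the Morse sets are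
the intersections of each `A (k + 1)` with the repeller in `K` dual to `A k`. -/
def IsMorseDecomposition (S : Flow ℝ≥0 X) (K : Set X) {l : ℕ} (M : Fin l → Set X) : Prop :=
  ∃ A : Fin (l + 1) → Set X,
    A 0 = ∅ ∧ A (Fin.last l) = K ∧ (∀ i j, i < j → A i ⊂ A j) ∧ (∀ i, IsAttractorIn S K (A i)) ∧
    ∀ k : Fin l, M k = A k.succ ∩ dualRepeller S K (A k.castSucc)

/-- `V` is a strict Morse-Lyapunov function of the Morse decomposition `M` of `K` on the
attraction basin of `K`. As a trajectory that enters a Morse set in finite time stays there and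
`V` is constant from then on, strict decrease along trajectories is required as long as they are
outside the Morse sets; since `x` ranges over all such points, it reads `V (S(t) x) < V x`. -/
structure IsStrictMorseLyapunov (S : Flow ℝ≥0 X) (K : Set X) {l : ℕ} (M : Fin l → Set X)
    (V : X → ℝ) : Prop where
  continuousOn : ContinuousOn V (basin S K)
  const : ∀ k, ∀ x ∈ M k, ∀ y ∈ M k, V x = V y
  decreasing : ∀ x ∈ basin S K, x ∉ ⋃ k, M k → ∀ t : ℝ≥0, 0 < t → V (S t x) < V x
  strict : ∀ i j, i < j → ∀ x ∈ M i, ∀ y ∈ M j, V x < V y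

/-- The generalized critical values of `V`: its values on the Morse sets. -/
def generalizedCriticalValues {l : ℕ} (M : Fin l → Set X) (V : X → ℝ) : Set ℝ :=
  {c | ∃ k, ∃ x ∈ M k, V x = c}

/-- The sublevel set `V_a = {x ∈ Ω | V x ≤ a}` in the attraction basin `Ω` of `K`. -/
def levelSet (S : Flow ℝ≥0 X) (K : Set X) (V : X → ℝ) (a : ℝ) : Set X :=
  {x | x ∈ basin S K ∧ V x ≤ a}

theorem levelSet_mono (S : Flow ℝ≥0 X) (K : Set X) (V : X → ℝ) {a b : ℝ} (h : a ≤ b) :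
    levelSet S K V a ⊆ levelSet S K V b :=
  fun _ hx => ⟨hx.1, hx.2.trans h⟩

end Dynamics

section Homology

open CategoryTheory CategoryTheory.Limits

variable {X : Type u} [TopologicalSpace X]

/-- The map of singular chain complexes with coefficients in `G` induced by `A ⊆ B`. -/
noncomputable def chainInclusion (G : Type v) [AddCommGroup G] {A B : Set X} (h : A ⊆ B) :
    ((AlgebraicTopology.singularChainComplexFunctor.{u} AddCommGrpCat.{max u v}).obj
        (AddCommGrpCat.of (ULift.{u} G))).obj (TopCat.of A) ⟶
      ((AlgebraicTopology.singularChainComplexFunctor.{u} AddCommGrpCat.{max u v}).obj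
        (AddCommGrpCat.of (ULift.{u} G))).obj (TopCat.of B) :=
  ((AlgebraicTopology.singularChainComplexFunctor.{u} AddCommGrpCat.{max u v}).obj
    (AddCommGrpCat.of (ULift.{u} G))).map
      (TopCat.ofHom ⟨Set.inclusion h, continuous_inclusion h⟩)

/-- The relative singular homology group `H_q(B, A; G)` of a pair `A ⊆ B` of subspaces of `X`:
the homology of the quotient of the singular chain complex of `B` by that of `A`. -/
noncomputable def relHomology (G : Type v) [AddCommGroup G] (q : ℕ) {A B : Set X} (h : A ⊆ B) :
    AddCommGrpCat.{max u v} :=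
  (cokernel (chainInclusion.{u, v} G h)).homology q

end Homology

end MorseAttractor

open MorseAttractor

namespace MorseAttractor

universe u v

/-! ### Relative homology of pairs under quasi-isomorphic inclusions. -/

section HomologyOfPairs

open CategoryTheory CategoryTheory.Limits AlgebraicTopology

variable {X : Type u} [TopologicalSpace X] (G : Type v) [AddCommGroup G]

/-! Both pairs are compared with `(V_c, V_a)`: it suffices that `V_c` is a deformation retract of
`V_b`, and `V_a` of `V_c \ {E}`; the five lemma then gives both isomorphisms.

Both retractions let a point flow until it first reaches the target level. From `V_b`, a trajectory
that never reaches level `c` must converge to `E`, since no Morse set has its level in `(c, b]` and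
only `E` has level `c`; it is stopped at `E` at time `∞`. From `V_c \ {E}`, every trajectory drops
below `c`, hence below `a`, in finite time.

The crux is `continuous_stoppedFlow`. The hitting time may jump, but only when the trajectory
lingers at the target level; then it already sits at `E`, and the stopped point does not jump.
Continuity at time `∞` rests on `exists_preimage_of_tendsto`: nearby long trajectories still above
level `c` are close to `E`. -/

theorem mono_chainInclusion {A B : Set X} (h : A ⊆ B) : Mono (chainInclusion.{u, v} G h) := by
  have : Mono (TopCat.ofHom (⟨Set.inclusion h, continuous_inclusion h⟩ : C(A, B))) := by
    rw [TopCat.mono_iff_injective]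
    exact Set.inclusion_injective h
  exact inferInstanceAs (Mono (((singularChainComplexFunctor.{u} AddCommGrpCat.{max u v}).obj
    (AddCommGrpCat.of (ULift.{u} G))).map (TopCat.ofHom _)))

theorem chainInclusion_comp {A B C : Set X} (h : A ⊆ B) (h' : B ⊆ C) :
    chainInclusion.{u, v} G h ≫ chainInclusion.{u, v} G h' =
      chainInclusion.{u, v} G (h.trans h') := by
  unfold chainInclusion
  rw [← Functor.map_comp]
  rfl

/-- If the inclusions `A ⊆ A'` and `B ⊆ B'` induce quasi-isomorphisms of singular chain complexes,
the pairs `(B, A)` and `(B', A')` have the same homology. -/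
theorem nonempty_relHomology_iso {A B A' B' : Set X} (hAB : A ⊆ B) (hAB' : A' ⊆ B')
    (hA : A ⊆ A') (hB : B ⊆ B') (qA : QuasiIso (chainInclusion.{u, v} G hA))
    (qB : QuasiIso (chainInclusion.{u, v} G hB)) (q : ℕ) :
    Nonempty (relHomology.{u, v} G q hAB ≅ relHomology.{u, v} G q hAB') := by
  have comm : chainInclusion.{u, v} G hAB ≫ chainInclusion.{u, v} G hB =
      chainInclusion.{u, v} G hA ≫ chainInclusion.{u, v} G hAB' := by
    rw [chainInclusion_comp, chainInclusion_comp]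
  have := mono_chainInclusion.{u, v} G hAB
  have := mono_chainInclusion.{u, v} G hAB'
  let S₁ := ShortComplex.mk _ _ (cokernel.condition (chainInclusion.{u, v} G hAB))
  let S₂ := ShortComplex.mk _ _ (cokernel.condition (chainInclusion.{u, v} G hAB'))
  have h₁ : S₁.ShortExact :=
    { exact := ShortComplex.exact_cokernel _
      mono_f := ‹_›
      epi_g := inferInstanceAs (Epi (cokernel.π _)) }
  have h₂ : S₂.ShortExact :=
    { exact := ShortComplex.exact_cokernel _
      mono_f := ‹_›
      epi_g := inferInstanceAs (Epi (cokernel.π _)) }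
  let φ : S₁ ⟶ S₂ :=
    { τ₁ := chainInclusion.{u, v} G hA
      τ₂ := chainInclusion.{u, v} G hB
      τ₃ := cokernel.map _ _ _ _ comm
      comm₁₂ := comm.symm
      comm₂₃ := by simp [S₁, S₂] }
  -- Five lemma on the two long exact homology sequences.
  have : QuasiIso φ.τ₃ := HomologicalComplex.HomologySequence.quasiIso_τ₃ φ h₁ h₂ qA qB
  have : IsIso (HomologicalComplex.homologyMap φ.τ₃ q) :=
    (quasiIsoAt_iff_isIso_homologyMap _ _).1 (quasiIso_iff _ |>.1 ‹_› q)
  exact ⟨@asIso _ _ _ _ _ this⟩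

/-- The inclusion of a deformation retract induces a quasi-isomorphism of singular chain
complexes. -/
theorem quasiIso_chainInclusion {A B : Set X} (h : A ⊆ B) (ρ : C(B, A))
    (hρ : ∀ x : A, ρ (Set.inclusion h x) = x)
    (H : ContinuousMap.Homotopy (ContinuousMap.id B)
      ((⟨Set.inclusion h, continuous_inclusion h⟩ : C(A, B)).comp ρ)) :
    QuasiIso (chainInclusion.{u, v} G h) := by
  let F := (singularChainComplexFunctor.{u} AddCommGrpCat.{max u v}).obj
    (AddCommGrpCat.of (ULift.{u} G))
  let i : TopCat.of A ⟶ TopCat.of B := TopCat.ofHom ⟨Set.inclusion h, continuous_inclusion h⟩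
  let r : TopCat.of B ⟶ TopCat.of A := TopCat.ofHom ρ
  have hri : i ≫ r = 𝟙 _ := by
    ext x
    exact congrArg Subtype.val (hρ x)
  let K : TopCat.Homotopy (𝟙 (TopCat.of B)) (r ≫ i) := H
  let e : HomotopyEquiv (F.obj (TopCat.of A)) (F.obj (TopCat.of B)) :=
    { hom := F.map i
      inv := F.map r
      homotopyHomInvId := Homotopy.ofEq (by rw [← F.map_comp, hri, F.map_id])
      homotopyInvHomId := ((Homotopy.ofEq (F.map_id _).symm).trans
        ((K.singularChainComplexFunctorObjMap (AddCommGrpCat.of (ULift.{u} G))).trans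
          (Homotopy.ofEq (F.map_comp r i)))).symm }
  exact e.quasiIso_hom

end HomologyOfPairs

/-! ### Stopping a semiflow at a sublevel set. -/

section Deformation

open scoped ENNReal unitInterval

variable {X : Type u} [TopologicalSpace X]

/-- The semiflow extended to the time `∞` by the constant value `E`. -/
noncomputable def extendedFlow (S : Flow ℝ≥0 X) (E : X) (t : ℝ≥0∞) (x : X) : X :=
  if t = ∞ then E else S t.toNNReal x

/-- The first time at which `V ≤ r` along the trajectory of `x`. -/
noncomputable def hittingTime (S : Flow ℝ≥0 X) (V : X → ℝ) (r : ℝ) (x : X) : ℝ≥0∞ :=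
  ⨅ (t : ℝ≥0) (_ : V (S t x) ≤ r), (t : ℝ≥0∞)

variable {S : Flow ℝ≥0 X} {E : X} {V : X → ℝ} {r : ℝ}

@[simp] theorem extendedFlow_top (x : X) : extendedFlow S E ∞ x = E := if_pos rfl

@[simp] theorem extendedFlow_coe (t : ℝ≥0) (x : X) : extendedFlow S E t x = S t x := by
  simp [extendedFlow]

theorem hittingTime_le {x : X} {t : ℝ≥0} (h : V (S t x) ≤ r) : hittingTime S V r x ≤ t :=
  iInf₂_le t h

theorem lt_of_lt_hittingTime {x : X} {t : ℝ≥0} (h : t < hittingTime S V r x) : r < V (S t x) := by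
  by_contra! h'
  exact h.not_ge (hittingTime_le h')

theorem hittingTime_eq_zero {x : X} (h : V x ≤ r) : hittingTime S V r x = 0 := by
  have : hittingTime S V r x ≤ (0 : ℝ≥0) := hittingTime_le (by simpa using h)
  simpa using this

theorem le_of_hittingTime_eq {x : X} (hx : Continuous fun t => V (S t x)) {T : ℝ≥0}
    (hT : hittingTime S V r x = T) : V (S T x) ≤ r := by
  by_contra! h
  obtain ⟨u, hu, hsub⟩ := exists_Ico_subset_of_mem_nhds
    (hx.continuousAt.eventually (lt_mem_nhds h)) ⟨T + 1, lt_add_one T⟩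
  have : (u : ℝ≥0∞) ≤ hittingTime S V r x := le_iInf₂ fun t ht => by
    by_contra! htu
    have hTt : T ≤ t := ENNReal.coe_le_coe.1 (hT ▸ hittingTime_le ht)
    exact (hsub ⟨hTt, ENNReal.coe_lt_coe.1 htu⟩ : r < V (S t x)).not_ge ht
  exact (hT ▸ this).not_gt (ENNReal.coe_lt_coe.2 hu)

/-- Passage to the limit from earlier times, where `V > r`. Positivity of `t` matters: at time `0`
the point may already lie strictly below level `r`. -/
theorem le_of_le_hittingTime {x : X} (hx : Continuous fun t => V (S t x)) {t : ℝ≥0}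
    (ht : 0 < t) (h : t ≤ hittingTime S V r x) : r ≤ V (S t x) := by
  have : t ∈ closure (Iio t) := by rw [closure_Iio' (a := t) ⟨0, ht⟩]; exact self_mem_Iic
  refine closure_minimal (s := Iio t) (t := {t | r ≤ V (S t x)}) (fun s hs => ?_)
    (isClosed_le continuous_const hx) this
  exact (lt_of_lt_hittingTime ((ENNReal.coe_lt_coe.2 hs).trans_le h)).le

variable {D : Set X}

/-- Flowing down to the sublevel set `V ≤ r`, trajectories that never reach it being sent to the
equilibrium `E` in infinite time, is continuous. -/
theorem continuous_stoppedFlow (hV : Continuous fun p : ℝ≥0 × D => V (S p.1 p.2))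
    (hmono : ∀ x ∈ D, Antitone fun t => V (S t x)) (hE : ∀ t, S t E = E)
    (hcrit : ∀ x ∈ D, ∀ t u, t < u → V (S t x) = r → V (S u x) = r → S t x = E)
    (hlim : ∀ x : D, Tendsto (fun p : ℝ≥0 × D => S p.1 p.2)
      ((atTop ×ˢ 𝓝 x) ⊓ 𝓟 {p | r ≤ V (S p.1 p.2)}) (𝓝 E)) :
    Continuous fun p : ℝ≥0∞ × D =>
      extendedFlow S E (min p.1 (hittingTime S V r p.2)) p.2 := by
  have hV' : ∀ x ∈ D, Continuous fun t => V (S t x) := fun x hx =>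
    hV.comp (Continuous.prodMk continuous_id (continuous_const (y := (⟨x, hx⟩ : D))))
  rw [continuous_iff_continuousAt]
  rintro ⟨s, x⟩
  rw [ContinuousAt, tendsto_iff_ultrafilter]
  intro U hU
  let τ : ℝ≥0∞ × D → ℝ≥0∞ := fun p => min p.1 (hittingTime S V r p.2)
  have hfst : Tendsto Prod.fst (U : Filter (ℝ≥0∞ × D)) (𝓝 s) :=
    (continuous_fst.tendsto (s, x)).mono_left hU
  have hsnd : Tendsto Prod.snd (U : Filter (ℝ≥0∞ × D)) (𝓝 x) :=
    (continuous_snd.tendsto (s, x)).mono_left hU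
  -- Compactness of `[0, ∞]` provides a limit `θ` of the stopped times along the ultrafilter, though
  -- the hitting time itself need not be continuous.
  obtain ⟨θ, hθ⟩ : ∃ θ, Tendsto τ U (𝓝 θ) := by
    obtain ⟨θ, -, h⟩ := isCompact_univ.ultrafilter_le_nhds (U.map τ) (by simp)
    exact ⟨θ, h⟩
  have hθs : θ ≤ s := le_of_tendsto_of_tendsto' hθ hfst fun p => min_le_left _ _
  have hnear : ∀ t : ℝ≥0, Tendsto (fun p : ℝ≥0∞ × D => V (S t p.2)) U (𝓝 (V (S t x))) :=
    fun t => (hV.tendsto (t, x)).comp (tendsto_const_nhds.prodMk_nhds hsnd)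
  have hbelow : ∀ t : ℝ≥0, (t : ℝ≥0∞) < θ → r ≤ V (S t x) := fun t ht => by
    refine ge_of_tendsto (hnear t) ?_
    filter_upwards [hθ.eventually (lt_mem_nhds ht)] with p hp
    exact (lt_of_lt_hittingTime (hp.trans_le (min_le_right _ _))).le
  -- the limit of the stopped times gives the right point
  have hpoint : extendedFlow S E θ x = extendedFlow S E (min s (hittingTime S V r x)) x := by
    rcases lt_trichotomy θ (min s (hittingTime S V r x)) with h | h | h
    -- Nearby points are stopped by the level, not by `s`, so `V ≤ r` there; in the limit `V (S θ x)
    -- ≤ r`, too early for `x`.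
    · exfalso
      lift θ to ℝ≥0 using h.ne_top
      have hlt := lt_min_iff.1 h
      refine (lt_of_lt_hittingTime hlt.2).not_ge ?_
      obtain ⟨m, hm₁, hm₂⟩ := exists_between hlt.1
      have hτ : Tendsto (fun p => (τ p).toNNReal) U (𝓝 θ) :=
        (ENNReal.tendsto_toNNReal (ENNReal.coe_ne_top (r := θ))).comp hθ
      refine le_of_tendsto ((hV.tendsto (θ, x)).comp (hτ.prodMk_nhds hsnd)) ?_
      filter_upwards [hθ.eventually (gt_mem_nhds hm₁), hfst.eventually (lt_mem_nhds hm₂)]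
        with p hp₁ hp₂
      have hlt' : hittingTime S V r p.2 < m := by
        rcases min_lt_iff.1 hp₁ with h' | h'
        · exact absurd h' hp₂.not_gt
        · exact h'
      have hτp : τ p = hittingTime S V r p.2 := min_eq_right (hlt'.trans hp₂).le
      refine le_of_hittingTime_eq (hV' _ p.2.2) (T := (τ p).toNNReal) ?_
      rw [hτp, ENNReal.coe_toNNReal hlt'.ne_top]
    · rw [h]
    -- Between the hitting time `T` and `θ`, `V` is at most `r` by monotonicity and at least `r` by
    -- `hbelow`. So the trajectory rests at `E` from `T` on, and both times give the same point.
    · have hT : hittingTime S V r x < θ := by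
        rcases min_lt_iff.1 h with h' | h'
        · exact absurd h' hθs.not_gt
        · exact h'
      rw [min_eq_right (hT.le.trans hθs)]
      obtain ⟨T, hTe⟩ : ∃ T : ℝ≥0, hittingTime S V r x = T :=
        ⟨_, (ENNReal.coe_toNNReal hT.ne_top).symm⟩
      rw [hTe] at hT ⊢
      obtain ⟨m, hm₁, hm₂⟩ := ENNReal.lt_iff_exists_nnreal_btwn.1 hT
      have hTm : T < m := ENNReal.coe_lt_coe.1 hm₁
      have h₁ := le_of_hittingTime_eq (hV' x x.2) hTe
      have h₂ := hbelow m hm₂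
      have h₃ : V (S m x) ≤ V (S T x) := hmono x x.2 hTm.le
      have hz : S T x = E := hcrit x x.2 T m hTm (by linarith) (by linarith)
      rw [extendedFlow_coe, hz]
      by_cases hθt : θ = ∞
      · rw [hθt, extendedFlow_top]
      · lift θ to ℝ≥0 using hθt
        rw [extendedFlow_coe, ← tsub_add_cancel_of_le (ENNReal.coe_lt_coe.1 hT).le, S.map_add,
          hz, hE]
  change Tendsto _ _ (𝓝 (extendedFlow S E (min s (hittingTime S V r x)) x))
  rw [← hpoint]
  by_cases hθt : θ = ∞
  · subst hθt
    rw [extendedFlow_top]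
    -- The ultrafilter decides whether the stopped times are infinite, giving the constant `E`, or
    -- finite and tending to `∞`, where `hlim` applies.
    rcases U.eventually_or.1 (Eventually.of_forall fun p => eq_or_ne (τ p) ∞) with h | h
    · refine tendsto_const_nhds.congr' ?_
      filter_upwards [h] with p hp
      change E = extendedFlow S E (τ p) p.2
      rw [hp, extendedFlow_top]
    · have hτ : Tendsto (fun p => (τ p).toNNReal) U atTop := by
        rw [tendsto_atTop]
        intro m
        filter_upwards [h, hθ.eventually (lt_mem_nhds (ENNReal.coe_lt_top (r := m)))] with p hp hm
        exact (ENNReal.le_toNNReal_of_coe_le hm.le hp)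
      have hlim' : Tendsto (fun p : ℝ≥0∞ × D => ((τ p).toNNReal, p.2)) U
          ((atTop ×ˢ 𝓝 x) ⊓ 𝓟 {p | r ≤ V (S p.1 p.2)}) := by
        refine tendsto_inf.2 ⟨hτ.prodMk hsnd, tendsto_principal.2 ?_⟩
        filter_upwards [h, hτ.eventually_gt_atTop 0] with p hp hp0
        refine le_of_le_hittingTime (hV' _ p.2.2) hp0 ?_
        rw [ENNReal.coe_toNNReal hp]
        exact min_le_right _ _
      refine ((hlim x).comp hlim').congr' ?_
      filter_upwards [h] with p hp
      change S (τ p).toNNReal p.2 = extendedFlow S E (τ p) p.2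
      rw [extendedFlow, if_neg hp]
  · lift θ to ℝ≥0 using hθt
    have hτ : Tendsto (fun p => (τ p).toNNReal) U (𝓝 θ) :=
      (ENNReal.tendsto_toNNReal (ENNReal.coe_ne_top (r := θ))).comp hθ
    have hS : Continuous fun p : ℝ≥0 × D => S p.1 p.2 :=
      S.continuous continuous_fst (continuous_subtype_val.comp continuous_snd)
    rw [extendedFlow_coe]
    refine ((hS.tendsto (θ, x)).comp (hτ.prodMk_nhds hsnd)).congr' ?_
    filter_upwards [hθ.eventually (gt_mem_nhds (ENNReal.coe_lt_top (r := θ)))] with p hp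
    change S (τ p).toNNReal p.2 = extendedFlow S E (τ p) p.2
    rw [extendedFlow, if_neg hp.ne]

/-- A forward invariant set retracts by deformation onto its sublevel set `V ≤ r`. -/
theorem quasiIso_chainInclusion_sublevel (G : Type v) [AddCommGroup G]
    (hD : ∀ x ∈ D, ∀ t, S t x ∈ D)
    (hV : Continuous fun p : ℝ≥0 × D => V (S p.1 p.2))
    (hmono : ∀ x ∈ D, Antitone fun t => V (S t x)) (hE : ∀ t, S t E = E)
    (hcrit : ∀ x ∈ D, ∀ t u, t < u → V (S t x) = r → V (S u x) = r → S t x = E)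
    (hlim : ∀ x : D, Tendsto (fun p : ℝ≥0 × D => S p.1 p.2)
      ((atTop ×ˢ 𝓝 x) ⊓ 𝓟 {p | r ≤ V (S p.1 p.2)}) (𝓝 E))
    (hend : ∀ x ∈ D, hittingTime S V r x = ∞ → E ∈ D ∧ V E ≤ r)
    {A : Set X} (h : A ⊆ D) (hA : ∀ x ∈ D, x ∈ A ↔ V x ≤ r) :
    _root_.QuasiIso (chainInclusion.{u, v} G h) := by
  have hcont := continuous_stoppedFlow hV hmono hE hcrit hlim
  have hmem : ∀ p : ℝ≥0∞ × D, extendedFlow S E (min p.1 (hittingTime S V r p.2)) p.2 ∈ D := by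
    rintro ⟨s, x⟩
    by_cases hs : min s (hittingTime S V r x) = ∞
    · simp only [hs, extendedFlow_top]
      exact (hend x x.2 (min_eq_top.1 hs).2).1
    · simp only [extendedFlow, if_neg hs]
      exact hD x x.2 _
  have hmemA : ∀ x : D, extendedFlow S E (hittingTime S V r x) x ∈ A := by
    intro x
    have hm := hmem (∞, x)
    simp only [min_top_left] at hm
    refine (hA _ hm).2 ?_
    by_cases hs : hittingTime S V r x = ∞
    · simp only [hs, extendedFlow_top]
      exact (hend x x.2 hs).2
    · simp only [extendedFlow, if_neg hs]
      exact le_of_hittingTime_eq (hV.comp (Continuous.prodMk continuous_id continuous_const))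
        (ENNReal.coe_toNNReal hs).symm
  -- Reparametrizes the time interval `[0, ∞]` as the unit interval of a homotopy.
  let e := ENNReal.orderIsoUnitIntervalBirational
  have he : Continuous e.symm := e.symm.continuous
  have he0 : e.symm 0 = 0 := e.symm.map_bot
  have he1 : e.symm 1 = ∞ := e.symm.map_top
  refine quasiIso_chainInclusion G h
    ⟨fun x => ⟨_, hmemA x⟩, Continuous.subtype_mk ?_ _⟩ (fun x => Subtype.ext ?_)
    { toFun := fun p => ⟨_, hmem (e.symm p.1, p.2)⟩
      continuous_toFun := Continuous.subtype_mk (hcont.comp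
        ((he.comp continuous_fst).prodMk continuous_snd)) _
      map_zero_left := fun x => Subtype.ext ?_
      map_one_left := fun x => Subtype.ext ?_ }
  · simpa [Function.comp_def] using
      hcont.comp (Continuous.prodMk (continuous_const (y := ∞)) continuous_id)
  · change extendedFlow S E (hittingTime S V r x) x = x
    rw [hittingTime_eq_zero ((hA x (h x.2)).1 x.2), ← ENNReal.coe_zero, extendedFlow_coe,
      S.map_zero_apply]
  · change extendedFlow S E (min (e.symm 0) _) x = x
    rw [he0, zero_min, ← ENNReal.coe_zero, extendedFlow_coe, S.map_zero_apply]
  · change extendedFlow S E (min (e.symm 1) _) x = extendedFlow S E (hittingTime S V r x) x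
    rw [he1, min_top_left]

end Deformation

/-! ### Uniform attraction and accumulation in the basin. -/

section Basin

variable {X : Type u} [MetricSpace X] {S : Flow ℝ≥0 X} {K : Set X}

theorem subset_basin (hK : ∀ t : ℝ≥0, S t '' K = K) : K ⊆ basin S K := by
  intro x hx
  refine tendsto_const_nhds.congr fun t => (Metric.infEDist_zero_of_mem ?_).symm
  exact hK t ▸ mem_image_of_mem _ hx

theorem tendsto_add_atTop (t : ℝ≥0) : Tendsto (· + t) atTop atTop :=
  tendsto_atTop_mono (fun _ => le_self_add) tendsto_id

theorem flow_mem_basin {x : X} (hx : x ∈ basin S K) (t : ℝ≥0) : S t x ∈ basin S K := by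
  have h := Tendsto.comp hx (tendsto_add_atTop t)
  exact h.congr fun s => congrArg (Metric.infEDist · K) (S.map_add s t x)

/-- An attractor attracts uniformly near each point of its basin. -/
theorem tendsto_infEDist_flow (hK : IsAttractor S K) {x : X} (hx : x ∈ basin S K) :
    Tendsto (fun p : ℝ≥0 × X => Metric.infEDist (S p.1 p.2) K) (atTop ×ˢ 𝓝 x) (𝓝 0) := by
  obtain ⟨hc, -, U, hU, hatt⟩ := hK
  obtain ⟨W, hW, hKW, hWU⟩ := mem_nhdsSet_iff_exists.1 hU
  obtain ⟨δ, hδ, hδW⟩ := hc.exists_thickening_subset_open hW hKW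
  -- One fixed time brings `x`, and by continuity its neighbours, into the uniformly attracted
  -- neighborhood.
  obtain ⟨t₀, ht₀⟩ : ∃ t₀, S t₀ x ∈ W := by
    obtain ⟨t₀, h⟩ := (hx.eventually (gt_mem_nhds (ENNReal.ofReal_pos.2 hδ))).exists
    exact ⟨t₀, hδW h⟩
  have hnear : ∀ᶠ y in 𝓝 x, S t₀ y ∈ W :=
    (S.continuous_toFun t₀).continuousAt.eventually (hW.mem_nhds ht₀)
  rw [ENNReal.tendsto_nhds_zero]
  intro ε hε
  obtain ⟨ε', hε'0, hε'⟩ := ENNReal.lt_iff_exists_nnreal_btwn.1 hε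
  obtain ⟨T, -, hT⟩ := hatt ε' (by exact_mod_cast hε'0)
  filter_upwards [(eventually_gt_atTop (T + t₀)).prod_mk hnear] with p hp
  have hlt : T < p.1 - t₀ := lt_tsub_iff_right.2 hp.1
  have hmem := hT _ hlt (mem_image_of_mem _ (hWU hp.2))
  rw [← S.map_add, tsub_add_cancel_of_le (le_add_self.trans hp.1.le)] at hmem
  have h := Metric.mem_thickening_iff_infEDist_lt.1 hmem
  rw [ENNReal.ofReal_coe_nnreal] at h
  exact (h.trans hε').le

/-- Trajectories starting near a point of the basin accumulate on the attractor. -/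
theorem exists_tendsto_of_tendsto_atTop (hK : IsAttractor S K) (hne : K.Nonempty)
    {x : X} (hx : x ∈ basin S K) {ι : Type*} (U : Ultrafilter ι) {t : ι → ℝ≥0} {y : ι → X}
    (ht : Tendsto t U atTop) (hy : Tendsto y U (𝓝 x)) :
    ∃ z ∈ K, Tendsto (fun i => S (t i) (y i)) U (𝓝 z) := by
  -- Nearest points on `K` converge along `U` by compactness, and the trajectories approach them.
  choose κ hκK hκ using fun p => hK.1.exists_infEDist_eq_edist hne p
  obtain ⟨z, hz, hlim⟩ := hK.1.ultrafilter_le_nhds (U.map fun i => κ (S (t i) (y i)))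
    (by rw [Ultrafilter.coe_map, le_principal_iff]; exact mem_map.2 (univ_mem' fun i => hκK _))
  refine ⟨z, hz, ?_⟩
  have hd : Tendsto (fun i => edist (S (t i) (y i)) (κ (S (t i) (y i)))) U (𝓝 0) :=
    ((tendsto_infEDist_flow hK hx).comp (ht.prodMk hy)).congr fun i => hκ _
  have hlim' : Tendsto (fun i => κ (S (t i) (y i))) U (𝓝 z) := hlim
  rw [tendsto_iff_edist_tendsto_0] at hlim' ⊢
  refine tendsto_of_tendsto_of_tendsto_of_le_of_le tendsto_const_nhds
    (by simpa using hd.add hlim') (fun _ => zero_le) fun i => edist_triangle _ _ _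

end Basin

/-! ### Morse sets and the limiting levels of trajectories. -/

section MorseSets

theorem mem_generalizedCriticalValues {X : Type u} {l : ℕ} {M : Fin l → Set X} {V : X → ℝ} {z : X}
    (hz : z ∈ ⋃ j, M j) : V z ∈ generalizedCriticalValues M V := by
  obtain ⟨j, hj⟩ := mem_iUnion.1 hz
  exact ⟨j, z, hj, rfl⟩

variable {X : Type u} [MetricSpace X] {S : Flow ℝ≥0 X} {K : Set X} {l : ℕ} {M : Fin l → Set X}

theorem IsMorseDecomposition.subset (hM : IsMorseDecomposition S K M) (j : Fin l) : M j ⊆ K := by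
  obtain ⟨A, -, -, -, hA, hMA⟩ := hM
  rw [hMA]
  exact inter_subset_left.trans (hA _).1

theorem IsMorseDecomposition.flow_mem (hM : IsMorseDecomposition S K M)
    {j : Fin l} {x : X} (hx : x ∈ M j) (t : ℝ≥0) : S t x ∈ M j := by
  obtain ⟨A, -, -, -, hA, hMA⟩ := hM
  rw [hMA] at hx ⊢
  obtain ⟨hxA, -, hω⟩ := hx
  have hm : S t x ∈ A j.succ := (hA j.succ).2.2.1 t ▸ mem_image_of_mem _ hxA
  refine ⟨hm, (hA _).1 hm, subset_empty_iff.1 (hω ▸ inter_subset_inter_left _ ?_)⟩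
  simpa using S.omegaLimit_image_subset (f := atTop) {x} t (tendsto_add_atTop t)

variable {V : X → ℝ}

namespace IsStrictMorseLyapunov

theorem antitone (hV : IsStrictMorseLyapunov S K M V) (hM : IsMorseDecomposition S K M)
    {x : X} (hx : x ∈ basin S K) : Antitone fun t => V (S t x) := by
  intro t u htu
  have hu : S u x = S (u - t) (S t x) := by rw [← S.map_add, tsub_add_cancel_of_le htu]
  change V (S u x) ≤ V (S t x)
  rw [hu]
  rcases eq_zero_or_pos (u - t) with h0 | h0
  · rw [h0, S.map_zero_apply]
  · by_cases hm : S t x ∈ ⋃ j, M j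
    · obtain ⟨j, hj⟩ := mem_iUnion.1 hm
      exact (hV.const j _ (hM.flow_mem hj _) _ hj).le
    · exact (hV.decreasing _ (flow_mem_basin hx t) hm _ h0).le

theorem continuous_flow (hV : IsStrictMorseLyapunov S K M V) {D : Set X}
    (hD : D ⊆ basin S K) : Continuous fun p : ℝ≥0 × D => V (S p.1 p.2) :=
  hV.continuousOn.comp_continuous
    (S.continuous continuous_fst (continuous_subtype_val.comp continuous_snd))
    fun p => flow_mem_basin (hD p.2.2) _

/-- The values of `V` along a trajectory come down to a value on a Morse set. -/
theorem exists_mem_iUnion (hV : IsStrictMorseLyapunov S K M V) (hM : IsMorseDecomposition S K M)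
    (hK : IsAttractor S K) (hne : K.Nonempty) {x : X} (hx : x ∈ basin S K) :
    ∃ z ∈ ⋃ j, M j, (∀ t, V z ≤ V (S t x)) ∧ ∀ r, V z < r → ∃ t, V (S t x) < r := by
  obtain ⟨z, hzK, hz⟩ := exists_tendsto_of_tendsto_atTop hK hne hx
    (Ultrafilter.of (atTop : Filter ℝ≥0)) (t := id) (y := fun _ => x)
    (Ultrafilter.of_le _) tendsto_const_nhds
  simp only [id] at hz
  have hzB := subset_basin hK.2.1 hzK
  have hlim : ∀ s : ℝ≥0, Tendsto (fun t => V (S s (S t x)))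
      (Ultrafilter.of (atTop : Filter ℝ≥0)) (𝓝 (V (S s z))) := fun s =>
    ((hV.continuous_flow Subset.rfl).tendsto (s, ⟨z, hzB⟩)).comp
      (tendsto_const_nhds.prodMk_nhds (tendsto_subtype_rng.2 hz :
        Tendsto (fun t => (⟨S t x, flow_mem_basin hx t⟩ : basin S K)) _ _))
  have hlim0 : Tendsto (fun t => V (S t x)) (Ultrafilter.of (atTop : Filter ℝ≥0)) (𝓝 (V z)) := by
    simpa using hlim 0
  have hle : ∀ t, V z ≤ V (S t x) := fun t => by
    refine le_of_tendsto hlim0 (Ultrafilter.of_le _ ?_)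
    filter_upwards [eventually_ge_atTop t] with u hu
    exact hV.antitone hM hx hu
  refine ⟨z, ?_, hle, fun r hr => (hlim0.eventually (gt_mem_nhds hr)).exists⟩
  -- Outside the Morse sets `V (S 1 z) < V z`, yet `V (S 1 z)` is a limit of values `V (S (1 + t) x)
  -- ≥ V z`.
  by_contra hz'
  refine (hV.decreasing z hzB hz' 1 one_pos).not_ge (ge_of_tendsto' (hlim 1) fun t => ?_)
  rw [← S.map_add]
  exact hle _

/-- If nearby trajectories stay at or above a level that the trajectory of `x` comes down to,
their limit points come from points of the Morse sets at that level. -/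
theorem exists_preimage_of_tendsto (hV : IsStrictMorseLyapunov S K M V)
    (hM : IsMorseDecomposition S K M) (hK : IsAttractor S K) (hne : K.Nonempty) {x : X}
    (hx : x ∈ basin S K) {r : ℝ} (hr : ∀ r', r < r' → ∃ t, V (S t x) < r')
    {ι : Type*} (U : Ultrafilter ι) {t : ι → ℝ≥0} {y : ι → X} (hyB : ∀ i, y i ∈ basin S K)
    (ht : Tendsto t U atTop) (hy : Tendsto y U (𝓝 x)) (hVr : ∀ᶠ i in U, r ≤ V (S (t i) (y i))) :
    ∃ z ∈ ⋃ j, M j, V z = r ∧ Tendsto (fun i => S (t i) (y i)) U (𝓝 (S 1 z)) := by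
  -- Taking the limit `z` one time unit earlier gives `r ≤ V (S 1 z) ≤ V z ≤ r`, and the absence of
  -- decrease forces `z` into a Morse set.
  have ht1 : Tendsto (fun i => t i - 1) U atTop := by
    rw [tendsto_atTop] at ht ⊢
    intro m
    filter_upwards [ht (m + 1)] with i hi
    exact le_tsub_of_add_le_right hi
  obtain ⟨z, hzK, hz⟩ := exists_tendsto_of_tendsto_atTop hK hne hx U ht1 hy
  have hzB := subset_basin hK.2.1 hzK
  have hS1 : ∀ᶠ i in U, S 1 (S (t i - 1) (y i)) = S (t i) (y i) := by
    filter_upwards [ht.eventually_ge_atTop 1] with i hi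
    rw [← S.map_add, add_tsub_cancel_of_le hi]
  have hlim : ∀ s : ℝ≥0, Tendsto (fun i => V (S s (S (t i - 1) (y i)))) U (𝓝 (V (S s z))) :=
    fun s => ((hV.continuous_flow Subset.rfl).tendsto (s, ⟨z, hzB⟩)).comp
      (tendsto_const_nhds.prodMk_nhds (tendsto_subtype_rng.2 hz :
        Tendsto (fun i => (⟨_, flow_mem_basin (hyB i) (t i - 1)⟩ : basin S K)) _ _))
  have hlim0 : Tendsto (fun i => V (S (t i - 1) (y i))) U (𝓝 (V z)) := by simpa using hlim 0
  have hge : r ≤ V (S 1 z) := ge_of_tendsto (hlim 1) <| by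
    filter_upwards [hS1, hVr] with i hi hi'
    rwa [hi]
  have hle : V z ≤ r := le_of_forall_gt_imp_ge_of_dense fun r' hr' => by
    obtain ⟨s, hs⟩ := hr r' hr'
    have hys : Tendsto (fun i => V (S s (y i))) U (𝓝 (V (S s x))) :=
      ((hV.continuous_flow Subset.rfl).tendsto (s, ⟨x, hx⟩)).comp
        (tendsto_const_nhds.prodMk_nhds (tendsto_subtype_rng.2 hy :
          Tendsto (fun i => (⟨_, hyB i⟩ : basin S K)) _ _))
    refine (le_of_tendsto_of_tendsto hlim0 hys ?_).trans hs.le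
    filter_upwards [ht1.eventually_ge_atTop s] with i hi
    exact hV.antitone hM (hyB i) hi
  have hmono : V (S 1 z) ≤ V z := by simpa using hV.antitone hM hzB (zero_le (a := (1 : ℝ≥0)))
  refine ⟨z, ?_, by linarith, ?_⟩
  · by_contra hz'
    exact (hV.decreasing z hzB hz' 1 one_pos).not_ge (hle.trans hge)
  · exact (((S.continuous_toFun 1).tendsto z).comp hz).congr' hS1

/-- A Morse set is determined by its level among the points of the Morse sets. -/
theorem mem_of_eq (hV : IsStrictMorseLyapunov S K M V) {k : Fin l} {x z : X} (hx : x ∈ M k)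
    (hz : z ∈ ⋃ j, M j) (h : V z = V x) : z ∈ M k := by
  obtain ⟨j, hj⟩ := mem_iUnion.1 hz
  rcases lt_trichotomy j k with hlt | rfl | hlt
  · exact absurd h (hV.strict _ _ hlt _ hj _ hx).ne
  · exact hj
  · exact absurd h (hV.strict _ _ hlt _ hx _ hj).ne'

theorem mem_iUnion_of_eq (hV : IsStrictMorseLyapunov S K M V) {x : X} (hx : x ∈ basin S K)
    {t u : ℝ≥0} (htu : t < u) (h : V (S t x) = V (S u x)) : S t x ∈ ⋃ j, M j := by
  by_contra hm
  refine (hV.decreasing _ (flow_mem_basin hx t) hm (u - t) (tsub_pos_of_lt htu)).ne ?_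
  rw [← S.map_add, tsub_add_cancel_of_le htu.le, h]

end IsStrictMorseLyapunov

end MorseSets

/-! ### The two deformation retractions of sublevel sets. -/

section LevelSets

variable {X : Type u} [MetricSpace X] {S : Flow ℝ≥0 X} {K : Set X} {l : ℕ} {M : Fin l → Set X}
  {V : X → ℝ} {k : Fin l} {E : X} {a b c : ℝ}

/-- The sublevel set above a critical level retracts by deformation onto the critical sublevel
set, if the Morse set is an equilibrium and there is no higher critical value in between. -/
theorem quasiIso_chainInclusion_levelSet (G : Type v) [AddCommGroup G] (hK : IsAttractor S K)
    (hM : IsMorseDecomposition S K M) (hV : IsStrictMorseLyapunov S K M V)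
    (hE : ∀ t : ℝ≥0, S t E = E) (hMk : M k = {E}) (hc : V E = c) (hcb : c ≤ b)
    (huniq : generalizedCriticalValues M V ∩ Icc c b = {c}) :
    QuasiIso (chainInclusion.{u, v} G (levelSet_mono S K V hcb)) := by
  have hEk : E ∈ M k := hMk ▸ rfl
  have hEK : E ∈ K := hM.subset k hEk
  have hne : K.Nonempty := ⟨E, hEK⟩
  have hcE : ∀ z ∈ ⋃ j, M j, V z = c → z = E := fun z hz h => by
    simpa [hMk] using hV.mem_of_eq hEk hz (h.trans hc.symm)
  have hsub : levelSet S K V b ⊆ basin S K := fun x hx => hx.1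
  refine quasiIso_chainInclusion_sublevel (D := levelSet S K V b) (E := E) (V := V)
    (r := c) G
    (fun x hx t => ⟨flow_mem_basin hx.1 t, ?_⟩) (hV.continuous_flow hsub)
    (fun x hx => hV.antitone hM hx.1) hE (fun x hx t u htu h₁ h₂ => ?_) (fun x => ?_)
    (fun _ _ _ => ⟨⟨subset_basin hK.2.1 hEK, hc.trans_le hcb⟩, hc.le⟩) _
    (fun x hx => ⟨fun h => h.2, fun h => ⟨hx.1, h⟩⟩)
  · have h := hV.antitone hM hx.1 (zero_le (a := t))
    simp only [S.map_zero_apply] at h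
    exact h.trans hx.2
  · exact hcE _ (hV.mem_iUnion_of_eq hx.1 htu (h₁.trans h₂.symm)) h₁
  · rw [tendsto_iff_ultrafilter]
    intro U hU
    have hU' := le_inf_iff.1 hU
    -- The limiting level of the trajectory is a critical value at most `b`, hence at most `c`.
    have hr : ∀ r', c < r' → ∃ t, V (S t x) < r' := by
      obtain ⟨z, hz, hzle, hzlt⟩ := hV.exists_mem_iUnion hM hK hne x.2.1
      have hzb : V z ≤ b := (hzle 0).trans (by simpa using x.2.2)
      have hzc : V z ≤ c := by
        by_contra! h
        have : V z ∈ ({c} : Set ℝ) := huniq ▸ ⟨mem_generalizedCriticalValues hz, h.le, hzb⟩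
        exact h.ne' this
      exact fun r' hr' => hzlt r' (hzc.trans_lt hr')
    obtain ⟨z, hz, hzc, hlim⟩ := hV.exists_preimage_of_tendsto hM hK hne x.2.1 hr U
      (t := Prod.fst) (y := fun p => (p.2 : X)) (fun p => p.2.2.1)
      (tendsto_fst.mono_left hU'.1)
      ((continuous_subtype_val.tendsto x).comp (tendsto_snd.mono_left hU'.1))
      (le_principal_iff.1 hU'.2)
    rwa [hcE z hz hzc, hE] at hlim

/-- The critical sublevel set without the equilibrium retracts by deformation onto a lower
sublevel set, if there is no lower critical value in between. -/
theorem quasiIso_chainInclusion_levelSet_diff (G : Type v) [AddCommGroup G] (hK : IsAttractor S K)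
    (hM : IsMorseDecomposition S K M) (hV : IsStrictMorseLyapunov S K M V)
    (hE : ∀ t : ℝ≥0, S t E = E) (hMk : M k = {E}) (hc : V E = c) (hac : a < c)
    (huniq : generalizedCriticalValues M V ∩ Icc a c = {c})
    (h : levelSet S K V a ⊆ levelSet S K V c \ M k) :
    QuasiIso (chainInclusion.{u, v} G h) := by
  have hEk : E ∈ M k := hMk ▸ rfl
  have hEK : E ∈ K := hM.subset k hEk
  have hne : K.Nonempty := ⟨E, hEK⟩
  have hcrit : ∀ z ∈ ⋃ j, M j, V z < c → V z < a := fun z hz hzc => by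
    by_contra! hza
    have : V z ∈ ({c} : Set ℝ) := huniq ▸ ⟨mem_generalizedCriticalValues hz, hza, hzc.le⟩
    exact hzc.ne this
  have hsub : levelSet S K V c \ M k ⊆ basin S K := fun x hx => hx.1.1
  -- A point of another Morse set in `V_c` is already below `c`; any other point decreases strictly.
  have hltc : ∀ x ∈ levelSet S K V c \ M k, ∃ t, V (S t x) < c := fun x hx => by
    by_cases hm : x ∈ ⋃ j, M j
    · refine ⟨0, ?_⟩
      rw [S.map_zero_apply]
      refine lt_of_le_of_ne hx.1.2 fun h => hx.2 (hV.mem_of_eq hEk hm (h.trans hc.symm))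
    · exact ⟨1, (hV.decreasing x hx.1.1 hm 1 one_pos).trans_le hx.1.2⟩
  have hlta : ∀ x ∈ levelSet S K V c \ M k, ∃ t, V (S t x) < a := fun x hx => by
    obtain ⟨t, ht⟩ := hltc x hx
    obtain ⟨z, hz, hzle, hzlt⟩ := hV.exists_mem_iUnion hM hK hne hx.1.1
    exact hzlt a (hcrit z hz ((hzle t).trans_lt ht))
  have hcont := hV.continuous_flow hsub
  refine quasiIso_chainInclusion_sublevel (D := levelSet S K V c \ M k) (E := E) (V := V)
    (r := a) G
    (fun x hx t => ⟨⟨flow_mem_basin hx.1.1 t, ?_⟩, fun hm => ?_⟩) hcont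
    (fun x hx => hV.antitone hM hx.1.1) hE (fun x hx t u htu h₁ h₂ => ?_) (fun x => ?_)
    (fun x hx htop => ?_) _ (fun x hx => ⟨fun h => h.2, fun h => ⟨hx.1.1, h⟩⟩)
  · have h := hV.antitone hM hx.1.1 (zero_le (a := t))
    simp only [S.map_zero_apply] at h
    exact h.trans hx.1.2
  -- A trajectory entering `E` would keep the value `c` forever, contradicting its drop below `c`.
  · obtain ⟨s, hs⟩ := hltc x hx
    have hle : V (S (s + t) x) ≤ V (S s x) := hV.antitone hM hx.1.1 le_self_add
    have hSt : S t x = E := by simpa [hMk] using hm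
    rw [S.map_add, hSt, hE, hc] at hle
    exact hle.not_gt hs
  · have hm := hV.mem_iUnion_of_eq hx.1.1 htu (h₁.trans h₂.symm)
    exact absurd h₁ (hcrit _ hm (h₁.trans_lt hac)).ne
  · obtain ⟨t, ht⟩ := hlta x x.2
    -- The limit condition is vacuous: all nearby trajectories are below `a` from a common time on.
    have hev : ∀ᶠ p : ℝ≥0 × ↥(levelSet S K V c \ M k) in atTop ×ˢ 𝓝 x, ¬ a ≤ V (S p.1 p.2) := by
      have hnear : ∀ᶠ y : ↥(levelSet S K V c \ M k) in 𝓝 x, V (S t y) < a :=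
        (hcont.comp (Continuous.prodMk_right t)).continuousAt.eventually (gt_mem_nhds ht)
      filter_upwards [(eventually_ge_atTop t).prod_mk hnear] with p hp
      exact not_le.2 ((hV.antitone hM p.2.2.1.1 hp.1).trans_lt hp.2)
    have hbot : (atTop ×ˢ 𝓝 x) ⊓ 𝓟 {p : ℝ≥0 × ↥(levelSet S K V c \ M k) | a ≤ V (S p.1 p.2)} = ⊥ :=
      inf_principal_eq_bot.2 hev
    rw [hbot]
    exact tendsto_bot
  · obtain ⟨t, ht⟩ := hlta x hx
    exact absurd (htop ▸ hittingTime_le ht.le) ENNReal.coe_lt_top.not_ge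

end LevelSets

end MorseAttractor

theorem propositiont {X : Type*} [MetricSpace X] [CompleteSpace X]
    (G : Type*) [AddCommGroup G]
    (S : Flow ℝ≥0 X) (hS : IsAsymptoticallyCompact S)
    (K : Set X) (hK : IsAttractor S K)
    {l : ℕ} (M : Fin l → Set X) (hM : IsMorseDecomposition S K M)
    (V : X → ℝ) (hV : IsStrictMorseLyapunov S K M V)
    (k : Fin l) (E : X) (hE : ∀ t : ℝ≥0, S t E = E) (hMk : M k = {E})
    (a b c : ℝ) (hc : V E = c) (hac : a < c) (hcb : c ≤ b)
    (huniq : generalizedCriticalValues M V ∩ Icc a b = {c}) (q : ℕ) :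
    Nonempty
      (relHomology G q (levelSet_mono S K V (hac.le.trans hcb)) ≅
        relHomology G q (sdiff_subset : levelSet S K V c \ M k ⊆ levelSet S K V c)) := by
  have hcv : c ∈ generalizedCriticalValues M V := ⟨k, E, hMk ▸ rfl, hc⟩
  have hsub : levelSet S K V a ⊆ levelSet S K V c \ M k := fun x hx =>
    ⟨levelSet_mono S K V hac.le hx, fun hm => by
      have hxE : x = E := by simpa [hMk] using hm
      exact (hxE ▸ hx.2).not_gt (hc ▸ hac)⟩
  have hupper : generalizedCriticalValues M V ∩ Icc c b = {c} :=
    Subset.antisymm (huniq ▸ inter_subset_inter_right _ (Icc_subset_Icc_left hac.le))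
      (singleton_subset_iff.2 ⟨hcv, le_rfl, hcb⟩)
  have hlower : generalizedCriticalValues M V ∩ Icc a c = {c} :=
    Subset.antisymm (huniq ▸ inter_subset_inter_right _ (Icc_subset_Icc_right hcb))
      (singleton_subset_iff.2 ⟨hcv, hac.le, le_rfl⟩)
  have hid : ∀ A : Set X, QuasiIso (chainInclusion G (Subset.refl A)) := fun A =>
    quasiIso_chainInclusion G _ (ContinuousMap.id A) (fun _ => rfl)
      (ContinuousMap.Homotopy.refl _)
  obtain ⟨e₁⟩ := nonempty_relHomology_iso G (levelSet_mono S K V hac.le)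
    (levelSet_mono S K V (hac.le.trans hcb)) Subset.rfl (levelSet_mono S K V hcb) (hid _)
    (quasiIso_chainInclusion_levelSet G hK hM hV hE hMk hc hcb hupper) q
  obtain ⟨e₂⟩ := nonempty_relHomology_iso G (levelSet_mono S K V hac.le)
    (sdiff_subset : levelSet S K V c \ M k ⊆ levelSet S K V c) hsub Subset.rfl
    (quasiIso_chainInclusion_levelSet_diff G hK hM hV hE hMk hc hac hlower hsub) (hid _) q
  exact ⟨e₁.symm ≪≫ e₂⟩
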